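/- For integers $n\ge \ell\ge 0$ let $K_n\setminus P_\ell$ denote the graph obtained from the complete graph $K_n$ on $n$ vertices by deleting the edges of a subgraph isomorphic to the path $P_\ell$ on $\ell$ vertices ($P_0$ being the graph without vertices). The spectrum of a finite simple graph is the multiset of eigenvalues of its adjacency matrix; two graphs are cospectral if they have the same spectrum, and two graphs with adjacency matrices $A$ and $B$ are $\mathbb{R}$-cospectral if $A+\alpha J$ and $B+\alpha J$ have the same spectrum for every $\alpha\in\mathbb{R}$, where $J$ denotes the all-one matrix of the appropriate order. Theorem. The graph $K_n\setminus P_\ell$ is determined by its generalized spectrum: every finite simple graph $H$ that is cospectral with $K_n\setminus P_\ell$ and whose complement is cospectral with the complement of $K_n\setminus P_\ell$ is isomorphic to $K_n\setminus P_\ell$. In particular, every graph that is $\mathbb{R}$-cospectral with $K_n\setminus P_\ell$ is isomorphic to it. -/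

import Mathlib

open Classical in
/-- The adjacency spectrum of a finite graph: the multiset of eigenvalues of its real adjacency
matrix, counted with multiplicity. -/
noncomputable def adjSpectrum {V : Type*} [Fintype V] (G : SimpleGraph V) : Multiset ℝ :=
  (G.adjMatrix ℝ).charpoly.roots

open Classical in
/-- The spectrum of `A + α J`, where `A` is the adjacency matrix of `G` and `J` is the all-one
matrix: its multiset of eigenvalues, counted with multiplicity. -/
noncomputable def shiftedSpectrum {V : Type*} [Fintype V] (G : SimpleGraph V) (α : ℝ) :
    Multiset ℝ :=
  (G.adjMatrix ℝ + α • Matrix.of (fun _ _ : V => (1 : ℝ))).charpoly.roots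

/-- Two finite graphs are cospectral if their adjacency matrices have the same spectrum. -/
def Cospectral {V W : Type*} [Fintype V] [Fintype W]
    (G : SimpleGraph V) (H : SimpleGraph W) : Prop :=
  adjSpectrum G = adjSpectrum H

/-- Two finite graphs have the same generalized spectrum if they are cospectral and so are
their complements. -/
def GeneralizedCospectral {V W : Type*} [Fintype V] [Fintype W]
    (G : SimpleGraph V) (H : SimpleGraph W) : Prop :=
  Cospectral G H ∧ Cospectral Gᶜ Hᶜ

/-- Two finite graphs with adjacency matrices `A` and `B` are `ℝ`-cospectral if `A + α J` and
`B + α J` have the same spectrum for every real `α`. -/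
def RCospectral {V W : Type*} [Fintype V] [Fintype W]
    (G : SimpleGraph V) (H : SimpleGraph W) : Prop :=
  ∀ α : ℝ, shiftedSpectrum G α = shiftedSpectrum H α

/-! Pass to complements: the deleted graph becomes a path plus isolated vertices. Equal
characteristic polynomials of `A` and `A - J` determine all walk counts `1ᵀ A^k 1`
(`walkSum_eq_of_charpoly_eq`), and the path forces every eigenvalue below 2, so no nonzero `x ≥ 0`
satisfies `2x ≤ Ax` (`eq_zero_of_two_mul_le_mulVec`).

Let `z v` be the sum of `deg u - 2` over the neighbours `u` of `v`. The sums of `z` and `z²` are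
combinations of walk counts, equal to -2 and 2 when `ℓ ≥ 4`; integrality then gives `z ≤ 0`
(`excess_nonpos`). A vertex of degree at least 3 would now yield a forbidden `x`
(`degree_le_two_of_excess_nonpos`). With all degrees at most 2, the sum of `z` leaves exactly two
leaves, cycles are again excluded by a forbidden `x` (`exists_isPathOn`), and the edge count fixes
the path length. -/

section LinearAlgebra

open Matrix

variable {V W : Type*} [Fintype V] [Fintype W] [DecidableEq V] [DecidableEq W]

/-! ### Walk counts from characteristic polynomials -/

/-- The matrix of power series whose coefficients are the powers of `M`. -/
noncomputable def powGenMatrix (M : Matrix V V ℝ) : Matrix V V (PowerSeries ℝ) :=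
  Matrix.of fun i j => PowerSeries.mk fun k => (M ^ k) i j

theorem one_sub_X_smul_mul_powGenMatrix (M : Matrix V V ℝ) :
    (1 - (PowerSeries.X : PowerSeries ℝ) • M.map PowerSeries.C) * powGenMatrix M = 1 := by
  rw [sub_mul, one_mul, smul_mul_assoc, sub_eq_iff_eq_add]
  ext i j k
  rw [Matrix.add_apply, Matrix.smul_apply, Matrix.mul_apply, smul_eq_mul, map_add]
  cases k with
  | zero => simp [powGenMatrix, Matrix.one_apply, apply_ite]
  | succ k =>
    rw [PowerSeries.coeff_succ_X_mul, map_sum]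
    have : PowerSeries.coeff (k + 1) ((1 : Matrix V V (PowerSeries ℝ)) i j) = 0 := by
      by_cases h : i = j <;> simp [Matrix.one_apply, h, PowerSeries.coeff_one]
    rw [this, zero_add]
    simp [powGenMatrix, pow_succ', Matrix.mul_apply]

/-- The number of walks of length `k`, for an arbitrary real matrix: the sum of the entries of
the `k`-th power. -/
def walkSum (M : Matrix V V ℝ) (k : ℕ) : ℝ := (1 : V → ℝ) ⬝ᵥ ((M ^ k) *ᵥ 1)

theorem coe_charpolyRev (M : Matrix V V ℝ) :
    (M.charpolyRev : PowerSeries ℝ) =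
      (1 - (PowerSeries.X : PowerSeries ℝ) • M.map PowerSeries.C).det := by
  rw [Matrix.charpolyRev]
  rw [← Polynomial.coeToPowerSeries.ringHom_apply, RingHom.map_det]
  congr 1
  ext i j : 2
  by_cases h : i = j <;> simp [h, mul_comm (PowerSeries.C (M _ _) : PowerSeries ℝ)]

theorem isUnit_det_one_sub_X_smul (M : Matrix V V ℝ) :
    IsUnit (1 - (PowerSeries.X : PowerSeries ℝ) • M.map PowerSeries.C).det :=
  Matrix.isUnit_det_of_right_inverse (one_sub_X_smul_mul_powGenMatrix M)

/-- `J` has rank one, so the matrix determinant lemma applies; the inverse of `1 - X M` is the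
geometric series `powGenMatrix M`, whose entries sum to the walk generating function. -/
theorem coe_charpolyRev_sub_ones (M : Matrix V V ℝ) :
    ((M - Matrix.of fun _ _ => 1).charpolyRev : PowerSeries ℝ) =
      (M.charpolyRev : PowerSeries ℝ) * (1 + PowerSeries.X * PowerSeries.mk (walkSum M)) := by
  rw [coe_charpolyRev, coe_charpolyRev]
  have h : (1 - (PowerSeries.X : PowerSeries ℝ) •
      (M - Matrix.of fun _ _ => (1 : ℝ)).map PowerSeries.C) =
      (1 - (PowerSeries.X : PowerSeries ℝ) • M.map PowerSeries.C) +
        replicateCol Unit (fun _ : V => (PowerSeries.X : PowerSeries ℝ)) *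
          replicateRow Unit (1 : V → PowerSeries ℝ) := by
    ext i j : 2
    simp [Matrix.mul_apply, mul_sub]
    ring
  rw [h, det_add_replicateCol_mul_replicateRow (isUnit_det_one_sub_X_smul M),
    Matrix.inv_eq_right_inv (one_sub_X_smul_mul_powGenMatrix M)]
  congr 1
  rw [det_unique]
  simp only [Matrix.add_apply, Matrix.one_apply_eq, Matrix.mul_apply, replicateCol_apply,
    replicateRow_apply, Pi.one_apply, one_mul, ← Finset.sum_mul]
  rw [mul_comm]
  congr 2
  ext k
  simp only [powGenMatrix, walkSum, dotProduct, mulVec, map_sum, Pi.one_apply, one_mul, mul_one,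
    PowerSeries.coeff_mk, Matrix.of_apply]
  exact Finset.sum_comm

theorem walkSum_eq_of_charpoly_eq {M : Matrix V V ℝ} {N : Matrix W W ℝ}
    (h : M.charpoly = N.charpoly)
    (h' : (M - Matrix.of fun _ _ => 1).charpoly = (N - Matrix.of fun _ _ => 1).charpoly) :
    walkSum M = walkSum N := by
  have e := coe_charpolyRev_sub_ones M
  have e' := coe_charpolyRev_sub_ones N
  rw [← reverse_charpoly, h', reverse_charpoly, e', ← reverse_charpoly, ← h, reverse_charpoly] at e
  have hu : IsUnit (M.charpolyRev : PowerSeries ℝ) := by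
    rw [coe_charpolyRev]
    exact isUnit_det_one_sub_X_smul M
  have e2 := add_left_cancel (hu.mul_left_cancel e)
  have e3 := mul_left_cancel₀ PowerSeries.X_ne_zero e2
  funext k
  simpa using (congrArg (PowerSeries.coeff k) e3).symm

theorem card_eq_of_charpoly_eq {M : Matrix V V ℝ} {N : Matrix W W ℝ}
    (h : M.charpoly = N.charpoly) : Fintype.card V = Fintype.card W := by
  rw [← M.charpoly_natDegree_eq_dim, h, N.charpoly_natDegree_eq_dim]

theorem charpoly_neg_one_add_eval (M : Matrix V V ℝ) (t : ℝ) :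
    (-(1 + M)).charpoly.eval t = (-1) ^ Fintype.card V * M.charpoly.eval (-(t + 1)) := by
  rw [eval_charpoly, eval_charpoly, ← det_neg]
  congr 1
  simp only [Matrix.scalar_apply, ← Matrix.smul_one_eq_diagonal]
  module

theorem charpoly_neg_one_add_eq {M : Matrix V V ℝ} {N : Matrix W W ℝ}
    (h : M.charpoly = N.charpoly) : (-(1 + M)).charpoly = (-(1 + N)).charpoly := by
  refine Polynomial.funext fun t => ?_
  rw [charpoly_neg_one_add_eval, charpoly_neg_one_add_eval, h, card_eq_of_charpoly_eq h]

theorem charpoly_eq_of_roots_eq {M : Matrix V V ℝ} {N : Matrix W W ℝ} (hM : M.IsHermitian)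
    (hN : N.IsHermitian) (h : M.charpoly.roots = N.charpoly.roots) :
    M.charpoly = N.charpoly := by
  rw [hM.splits_charpoly.eq_prod_roots_of_monic M.charpoly_monic,
    hN.splits_charpoly.eq_prod_roots_of_monic N.charpoly_monic, h]

/-! ### Eigenvalue bounds and moments of the excess vector -/

theorem exists_mulVec_eq_smul_of_isRoot {M : Matrix V V ℝ} {μ : ℝ} (h : M.charpoly.IsRoot μ) :
    ∃ v : V → ℝ, v ≠ 0 ∧ M *ᵥ v = μ • v := by
  rw [Polynomial.IsRoot, eval_charpoly] at h
  obtain ⟨v, hv, hv'⟩ := Matrix.exists_mulVec_eq_zero_iff.2 h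
  refine ⟨v, hv, ?_⟩
  rw [sub_mulVec, sub_eq_zero, Matrix.scalar_apply, ← Matrix.smul_one_eq_diagonal,
    smul_mulVec, one_mulVec] at hv'
  exact hv'.symm

/-- A symmetric matrix all of whose eigenvalues are less than `2` has no nonzero
nonnegative vector `x` with `2 x ≤ M x`. -/
theorem eq_zero_of_two_mul_le_mulVec {M : Matrix V V ℝ} (hM : M.IsHermitian)
    (hlt : ∀ μ, M.charpoly.IsRoot μ → μ < 2) {x : V → ℝ} (hx : ∀ v, 0 ≤ x v)
    (hMx : ∀ v, 2 * x v ≤ (M *ᵥ x) v) : x = 0 := by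
  have hH : ((2 : ℝ) • (1 : Matrix V V ℝ) - M).IsHermitian :=
    (Matrix.isHermitian_one.smul (by simp [IsSelfAdjoint])).sub hM
  have hP : ((2 : ℝ) • (1 : Matrix V V ℝ) - M).PosDef := by
    rw [hH.posDef_iff_eigenvalues_pos]
    intro i
    -- An eigenvalue `λ` of `2 - M` gives the eigenvalue `2 - λ < 2` of `M`, so `λ > 0`.
    have hr : M.charpoly.IsRoot (2 - hH.eigenvalues i) := by
      rw [Polynomial.IsRoot, eval_charpoly, ← Matrix.exists_mulVec_eq_zero_iff]
      have hne : (hH.eigenvectorBasis i).ofLp ≠ 0 := by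
        intro h0
        have := hH.eigenvectorBasis.orthonormal.ne_zero i
        exact this (by ext j; simp [h0])
      refine ⟨_, hne, ?_⟩
      have := hH.mulVec_eigenvectorBasis i
      rw [sub_mulVec, smul_mulVec, one_mulVec] at this
      rw [sub_mulVec, Matrix.scalar_apply, ← Matrix.smul_one_eq_diagonal, smul_mulVec,
        one_mulVec, sub_smul, ← this]
      simp
    linarith [hlt _ hr]
  by_contra h0
  have := hP.dotProduct_mulVec_pos h0
  rw [star_trivial, sub_mulVec, smul_mulVec, one_mulVec] at this
  have h1 : x ⬝ᵥ ((2 : ℝ) • x - M *ᵥ x) ≤ 0 :=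
    Finset.sum_nonpos fun v _ => mul_nonpos_of_nonneg_of_nonpos (hx v) (by
      simp only [Pi.sub_apply, Pi.smul_apply, smul_eq_mul]; linarith [hMx v])
  linarith

theorem walkSum_one (M : Matrix V V ℝ) : walkSum M 1 = ∑ v, (M *ᵥ 1) v := by
  simp [walkSum, dotProduct]

theorem walkSum_add {M : Matrix V V ℝ} (hM : M.IsSymm) (j k : ℕ) :
    walkSum M (j + k) = ((M ^ j) *ᵥ 1) ⬝ᵥ ((M ^ k) *ᵥ 1) := by
  rw [walkSum, pow_add, ← mulVec_mulVec, dotProduct_mulVec, ← mulVec_transpose,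
    Matrix.transpose_pow, hM.eq]

/-- `M (M 1 - 2)`. -/
def excessVec (M : Matrix V V ℝ) : V → ℝ := M *ᵥ (M *ᵥ 1 - (2 : ℝ) • 1)

theorem excessVec_eq (M : Matrix V V ℝ) :
    excessVec M = (M ^ 2) *ᵥ 1 - (2 : ℝ) • (M ^ 1 *ᵥ 1) := by
  rw [excessVec, mulVec_sub, mulVec_mulVec, mulVec_smul, pow_two, pow_one]

theorem sum_excessVec (M : Matrix V V ℝ) :
    ∑ v, excessVec M v = walkSum M 2 - 2 * walkSum M 1 := by
  rw [excessVec_eq]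
  simp [walkSum, dotProduct, Finset.sum_sub_distrib, Finset.mul_sum]

theorem sum_excessVec_sq {M : Matrix V V ℝ} (hM : M.IsSymm) :
    ∑ v, excessVec M v ^ 2 = walkSum M 4 - 4 * walkSum M 3 + 4 * walkSum M 2 := by
  rw [walkSum_add hM 2 2, walkSum_add hM 2 1, walkSum_add hM 1 1, excessVec_eq]
  simp only [dotProduct, Finset.mul_sum, ← Finset.sum_sub_distrib, ← Finset.sum_add_distrib]
  refine Finset.sum_congr rfl fun v _ => ?_
  simp only [Pi.sub_apply, Pi.smul_apply, smul_eq_mul]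
  ring

end LinearAlgebra

/-! ### Paths with isolated vertices -/

section Paths

open Matrix
open scoped Classical

variable {V W : Type*}

/-- The edges of `G` are exactly those of a path through the distinct vertices
`f 0, …, f (ℓ - 1)`. -/
structure SimpleGraph.IsPathOn (G : SimpleGraph V) (f : ℕ → V) (ℓ : ℕ) : Prop where
  inj : Set.InjOn f (Set.Iio ℓ)
  adj : ∀ u v, G.Adj u v ↔
    ∃ i, i + 1 < ℓ ∧ (u = f i ∧ v = f (i + 1) ∨ v = f i ∧ u = f (i + 1))

namespace SimpleGraph.IsPathOn

variable {G : SimpleGraph V} {f : ℕ → V} {ℓ : ℕ}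

theorem eq_of_apply_eq (h : G.IsPathOn f ℓ) {i j : ℕ} (hi : i < ℓ) (hj : j < ℓ)
    (hij : f i = f j) : i = j := h.inj hi hj hij

theorem adj_apply (h : G.IsPathOn f ℓ) {i : ℕ} (hi : i < ℓ) (u : V) :
    G.Adj (f i) u ↔ i + 1 < ℓ ∧ u = f (i + 1) ∨ 0 < i ∧ u = f (i - 1) := by
  rw [h.adj]
  constructor
  · rintro ⟨j, hj, ⟨h1, h2⟩ | ⟨h1, h2⟩⟩
    · obtain rfl := h.eq_of_apply_eq hi (by omega) h1
      exact Or.inl ⟨hj, h2⟩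
    · obtain rfl := h.eq_of_apply_eq hi hj h2
      exact Or.inr ⟨by omega, by simpa using h1⟩
  · rintro (⟨h1, h2⟩ | ⟨h1, h2⟩)
    · exact ⟨i, h1, Or.inl ⟨rfl, h2⟩⟩
    · exact ⟨i - 1, by omega, Or.inr ⟨h2, by rw [Nat.sub_add_cancel h1]⟩⟩

theorem exists_of_adj (h : G.IsPathOn f ℓ) {u v : V} (huv : G.Adj u v) : ∃ i < ℓ, u = f i := by
  obtain ⟨j, hj, ⟨h1, -⟩ | ⟨-, h2⟩⟩ := (h.adj u v).1 huv
  exacts [⟨j, by omega, h1⟩, ⟨j + 1, hj, h2⟩]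

variable [Fintype V]

theorem mulVec_apply (h : G.IsPathOn f ℓ) (x : V → ℝ) {i : ℕ} (hi : i < ℓ) :
    (G.adjMatrix ℝ *ᵥ x) (f i) =
      (if i + 1 < ℓ then x (f (i + 1)) else 0) + (if 0 < i then x (f (i - 1)) else 0) := by
  have hN : G.neighborFinset (f i) =
      (if i + 1 < ℓ then {f (i + 1)} else ∅) ∪ (if 0 < i then {f (i - 1)} else ∅) := by
    ext u
    rw [mem_neighborFinset, h.adj_apply hi]
    split_ifs <;> simp [*]
  rw [adjMatrix_mulVec_apply, hN, Finset.sum_union]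
  · split_ifs <;> simp
  · split_ifs <;> simp
    intro h1
    have := h.eq_of_apply_eq (by omega) (by omega) h1
    omega

theorem mulVec_apply_of_notMem (h : G.IsPathOn f ℓ) (x : V → ℝ) {v : V}
    (hv : ∀ i < ℓ, v ≠ f i) : (G.adjMatrix ℝ *ᵥ x) v = 0 := by
  rw [adjMatrix_mulVec_apply]
  refine Finset.sum_eq_zero fun u hu => ?_
  obtain ⟨i, hi, h1⟩ := h.exists_of_adj ((mem_neighborFinset _ _ _).1 hu)
  exact absurd h1 (hv i hi)

theorem sum_eq (h : G.IsPathOn f ℓ) {g : V → ℝ} (hg : ∀ v, (∀ i < ℓ, v ≠ f i) → g v = 0) :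
    ∑ v, g v = ∑ i ∈ Finset.range ℓ, g (f i) := by
  rw [← Finset.sum_image (s := Finset.range ℓ) (g := f) (f := g)]
  · refine (Finset.sum_subset (Finset.subset_univ _) fun v _ hv => hg v fun i hi hvi => hv ?_).symm
    exact Finset.mem_image.2 ⟨i, Finset.mem_range.2 hi, hvi.symm⟩
  · intro i hi j hj
    exact h.eq_of_apply_eq (by simpa using hi) (by simpa using hj)

theorem mulVec_one_apply (h : G.IsPathOn f ℓ) (hℓ : 2 ≤ ℓ) {i : ℕ} (hi : i < ℓ) :
    (G.adjMatrix ℝ *ᵥ 1) (f i) =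
      2 - ((if i = 0 then 1 else 0) + (if i = ℓ - 1 then 1 else 0)) := by
  rw [h.mulVec_apply 1 hi]
  simp only [Pi.one_apply]
  split_ifs <;> first | contradiction | omega | norm_num

/-- On the path, `A 1 - 2` is -1 at each end and 0 inside; `A` moves each -1 to the adjacent path
vertex. For `ℓ = 3` both land on the middle vertex, hence the sum of two indicators. -/
theorem excessVec_apply (h : G.IsPathOn f ℓ) (hℓ : 2 ≤ ℓ) {i : ℕ} (hi : i < ℓ) :
    excessVec (G.adjMatrix ℝ) (f i) =
      -((if i = 1 then 1 else 0) + (if i = ℓ - 2 then 1 else 0)) := by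
  rw [excessVec, h.mulVec_apply _ hi]
  have key : ∀ j < ℓ, (G.adjMatrix ℝ *ᵥ 1 - (2 : ℝ) • (1 : V → ℝ)) (f j) =
      -((if j = 0 then 1 else 0) + (if j = ℓ - 1 then 1 else 0)) := by
    intro j hj
    rw [Pi.sub_apply, h.mulVec_one_apply hℓ hj]
    simp
  split_ifs <;> first
    | omega
    | (rw [key _ (by omega), key _ (by omega)]; split_ifs <;> first | contradiction | omega | norm_num)
    | (rw [key _ (by omega)]; split_ifs <;> first | contradiction | omega | norm_num)

theorem excessVec_apply_of_notMem (h : G.IsPathOn f ℓ) {v : V}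
    (hv : ∀ i < ℓ, v ≠ f i) : excessVec (G.adjMatrix ℝ) v = 0 :=
  h.mulVec_apply_of_notMem _ hv

theorem walkSum_one (h : G.IsPathOn f ℓ) (hℓ : 2 ≤ ℓ) :
    walkSum (G.adjMatrix ℝ) 1 = 2 * ((ℓ : ℝ) - 1) := by
  rw [_root_.walkSum_one, h.sum_eq fun v hv => h.mulVec_apply_of_notMem _ hv,
    Finset.sum_congr rfl fun i hi => h.mulVec_one_apply hℓ (Finset.mem_range.1 hi)]
  rw [Finset.sum_sub_distrib, Finset.sum_add_distrib, Finset.sum_ite_eq', Finset.sum_ite_eq',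
    if_pos (by simp; omega), if_pos (by simp; omega)]
  simp
  ring

theorem sum_excessVec (h : G.IsPathOn f ℓ) (hℓ : 2 ≤ ℓ) :
    ∑ v, excessVec (G.adjMatrix ℝ) v = -2 := by
  rw [h.sum_eq fun v hv => h.excessVec_apply_of_notMem hv,
    Finset.sum_congr rfl fun i hi => h.excessVec_apply hℓ (Finset.mem_range.1 hi)]
  rw [Finset.sum_neg_distrib, Finset.sum_add_distrib, Finset.sum_ite_eq', Finset.sum_ite_eq',
    if_pos (by simp; omega), if_pos (by simp; omega)]
  norm_num

/-- For `ℓ ≥ 4` the indices `1` and `ℓ - 2` differ, so every entry `z` is 0 or -1 and `z² = -z`. -/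
theorem sum_excessVec_sq (h : G.IsPathOn f ℓ) (hℓ : 4 ≤ ℓ) :
    ∑ v, excessVec (G.adjMatrix ℝ) v ^ 2 = 2 := by
  rw [← neg_neg (∑ v, _), ← Finset.sum_neg_distrib, ← neg_neg (2 : ℝ),
    ← h.sum_excessVec (by omega)]
  refine congrArg _ (Finset.sum_congr rfl fun v _ => ?_)
  by_cases hv : ∃ i < ℓ, v = f i
  · obtain ⟨i, hi, rfl⟩ := hv
    rw [h.excessVec_apply (by omega) hi]
    split_ifs <;> first | contradiction | omega | norm_num
  · push Not at hv
    rw [h.excessVec_apply_of_notMem hv]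
    norm_num

theorem lt_two_of_isRoot (h : G.IsPathOn f ℓ) {μ : ℝ}
    (hμ : (G.adjMatrix ℝ).charpoly.IsRoot μ) : μ < 2 := by
  obtain ⟨x, hx0, hx⟩ := exists_mulVec_eq_smul_of_isRoot hμ
  by_contra! h2
  obtain ⟨w, hw⟩ := Function.ne_iff.1 hx0
  obtain ⟨m, -, hm⟩ := Finset.exists_max_image Finset.univ (fun v => |x v|) ⟨w, Finset.mem_univ w⟩
  have hm' : ∀ v, |x v| ≤ |x m| := fun v => hm v (Finset.mem_univ v)
  have hpos : 0 < |x m| := (abs_pos.2 hw).trans_le (hm' w)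
  have hex : ∃ i, i < ℓ ∧ |x (f i)| = |x m| := by
    by_contra! hne
    have h0 := h.mulVec_apply_of_notMem x (v := m) fun i hi e => hne i hi (by rw [e])
    rw [hx, Pi.smul_apply, smul_eq_mul] at h0
    have := abs_pos.1 hpos
    rcases mul_eq_zero.1 h0 with h0 | h0
    · linarith
    · exact this h0
  obtain ⟨hi, hix⟩ := Nat.find_spec hex
  -- At the first path index where `|x|` is maximal, the preceding entry is strictly smaller, so `μ
  -- |x| < 2 |x|`.
  have hmin := fun j => Nat.find_min hex (m := j)
  set i := Nat.find hex
  have e := congrArg abs (h.mulVec_apply x hi)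
  rw [hx, Pi.smul_apply, smul_eq_mul, abs_mul, hix, abs_of_nonneg (by linarith : (0 : ℝ) ≤ μ)] at e
  have h3 := abs_add_le (if i + 1 < ℓ then x (f (i + 1)) else 0)
    (if 0 < i then x (f (i - 1)) else 0)
  have h4 : |(if i + 1 < ℓ then x (f (i + 1)) else 0)| ≤ |x m| := by
    split_ifs
    · exact hm' _
    · simp
  have h5 : |(if 0 < i then x (f (i - 1)) else 0)| < |x m| := by
    split_ifs with hi0
    · exact lt_of_le_of_ne (hm' _) fun he => hmin (i - 1) (by omega) ⟨by omega, he⟩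
    · simpa using hpos
  nlinarith

/-- Two graphs of the same order whose edges form paths of the same length are isomorphic. -/
theorem nonempty_iso [Fintype W] (h : G.IsPathOn f ℓ) {H : SimpleGraph W} {g : ℕ → W}
    (h' : H.IsPathOn g ℓ) (hc : Fintype.card V = Fintype.card W) : Nonempty (G ≃g H) := by
  obtain ⟨e, he⟩ : ∃ e : V ≃ W, ∀ i < ℓ, e (f i) = g i := by
    let k : V → W := fun v => if hv : ∃ i < ℓ, v = f i then g hv.choose
      else (Fintype.equivOfCardEq hc) v
    have hk : ∀ i < ℓ, k (f i) = g i := by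
      intro i hi
      have hv : ∃ j < ℓ, f i = f j := ⟨i, hi, rfl⟩
      simp only [k, dif_pos hv]
      rw [← h.eq_of_apply_eq hi hv.choose_spec.1 hv.choose_spec.2]
    have hinj : Set.InjOn k ((Finset.range ℓ).image f : Finset V) := by
      intro a ha b hb hab
      simp only [Finset.coe_image, Finset.coe_range, Set.mem_image, Set.mem_Iio] at ha hb
      obtain ⟨i, hi, rfl⟩ := ha
      obtain ⟨j, hj, rfl⟩ := hb
      rw [hk i hi, hk j hj] at hab
      rw [h'.eq_of_apply_eq hi hj hab]
    obtain ⟨e, he⟩ := Finset.exists_equiv_extend_of_card_eq (t := (Finset.univ : Finset W))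
      (by rw [hc, Finset.card_univ]) (Finset.subset_univ _) hinj
    refine ⟨e.trans (Equiv.subtypeUnivEquiv Finset.mem_univ), fun i hi => ?_⟩
    have := he (f i) (Finset.mem_image_of_mem _ (Finset.mem_range.2 hi))
    simpa [hk i hi] using this
  refine ⟨⟨e, fun {u v} => ?_⟩⟩
  rw [h.adj, h'.adj]
  refine exists_congr fun i => and_congr_right fun hi => ?_
  rw [← he i (by omega), ← he (i + 1) hi]
  simp only [e.injective.eq_iff]

end SimpleGraph.IsPathOn

end Paths

/-! ### Recovering the path from degrees and superharmonic vectors -/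

section Degrees

open Matrix
open scoped Classical

variable {V W : Type*} [Fintype V]

namespace SimpleGraph

variable (G : SimpleGraph V)

/-- No nonzero nonnegative vector `x` satisfies `2 x ≤ A x`, with `A` the adjacency matrix. -/
def NoTwoSuperharmonic : Prop :=
  ∀ x : V → ℝ, (∀ v, 0 ≤ x v) → (∀ v, 2 * x v ≤ ∑ u ∈ G.neighborFinset v, x u) → x = 0

variable {G}

theorem neighborFinset_eq_singleton {u v : V} (hv : G.degree v = 1) (h : G.Adj v u) :
    G.neighborFinset v = {u} := by
  obtain ⟨a, ha⟩ := Finset.card_eq_one.1 hv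
  have : u ∈ G.neighborFinset v := by simpa using h
  rw [ha, Finset.mem_singleton] at this
  rw [ha, this]

theorem exists_neighborFinset_eq_pair {u v : V} (hv : G.degree v = 2) (h : G.Adj v u) :
    ∃ w, u ≠ w ∧ G.neighborFinset v = {u, w} := by
  obtain ⟨a, b, hab, h2⟩ := Finset.card_eq_two.1 hv
  have : u ∈ G.neighborFinset v := by simpa using h
  rw [h2, Finset.mem_insert, Finset.mem_singleton] at this
  rcases this with rfl | rfl
  · exact ⟨b, hab, h2⟩
  · exact ⟨a, hab.symm, by rw [h2, Finset.pair_comm]⟩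

theorem neighborFinset_eq_pair {u v w : V} (hv : G.degree v = 2) (hu : G.Adj v u)
    (hw : G.Adj v w) (huw : u ≠ w) : G.neighborFinset v = {u, w} := by
  refine (Finset.eq_of_subset_of_card_le ?_ ?_).symm
  · simp [Finset.insert_subset_iff, hu, hw]
  · rw [Finset.card_pair huw, card_neighborFinset_eq_degree, hv]

theorem one_le_degree_of_adj {u v : V} (h : G.Adj v u) : 1 ≤ G.degree v :=
  (G.degree_pos_iff_exists_adj v).2 ⟨u, h⟩

/-- The weights 3, 2, 1 are those of the affine diagram `E₆`: a centre with arms of length two. The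
sign condition on the excess forces enough of this shape around any vertex of degree at least 3 to
give `2x ≤ Ax`. -/
theorem degree_le_two_of_excess_nonpos (hS : G.NoTwoSuperharmonic)
    (hz : ∀ v, ∑ u ∈ G.neighborFinset v, ((G.degree u : ℤ) - 2) ≤ 0) (v : V) :
    G.degree v ≤ 2 := by
  let x : V → ℝ := fun v =>
    if 3 ≤ G.degree v then 3
    else if G.degree v = 2 ∧ ∃ u, G.Adj v u ∧ 3 ≤ G.degree u then 2
    else if G.degree v = 1 ∧ ∃ u, G.Adj v u ∧ G.degree u = 2 ∧ ∃ w, G.Adj u w ∧ 3 ≤ G.degree w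
    then 1 else 0
  have x3 : ∀ v, 3 ≤ G.degree v → x v = 3 := fun v hv => if_pos hv
  have x2 : ∀ v, G.degree v = 2 → (∃ u, G.Adj v u ∧ 3 ≤ G.degree u) → x v = 2 := by
    intro v hv h
    simp only [x]
    rw [if_neg (by omega), if_pos ⟨hv, h⟩]
  have x1 : ∀ v, G.degree v = 1 →
      (∃ u, G.Adj v u ∧ G.degree u = 2 ∧ ∃ w, G.Adj u w ∧ 3 ≤ G.degree w) → x v = 1 := by
    intro v hv h
    simp only [x]
    rw [if_neg (by omega), if_neg (by omega), if_pos ⟨hv, h⟩]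
  have x0 : ∀ v, 0 ≤ x v := by
    intro v
    simp only [x]
    split_ifs <;> norm_num
  have hx := hS x x0 fun v => by
    by_cases h3 : 3 ≤ G.degree v
    · rw [x3 v h3]
      have h : ∀ u ∈ G.neighborFinset v, (2 : ℝ) ≤ x u := by
        intro u hu
        have hvu : G.Adj v u := by simpa using hu
        have h1 := one_le_degree_of_adj hvu.symm
        by_cases hu3 : 3 ≤ G.degree u
        · rw [x3 u hu3]
          norm_num
        by_cases hu2 : G.degree u = 2
        · rw [x2 u hu2 ⟨v, hvu.symm, h3⟩]
        -- A leaf `u` attached to `v` would have excess `deg v - 2 > 0`.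
        have hz' := hz u
        rw [neighborFinset_eq_singleton (by omega) hvu.symm, Finset.sum_singleton] at hz'
        omega
      have := Finset.card_nsmul_le_sum _ _ _ h
      rw [card_neighborFinset_eq_degree, nsmul_eq_mul] at this
      have : (3 : ℝ) ≤ G.degree v := by exact_mod_cast h3
      linarith
    by_cases h2 : G.degree v = 2 ∧ ∃ u, G.Adj v u ∧ 3 ≤ G.degree u
    · rw [x2 v h2.1 h2.2]
      obtain ⟨hv2, u, hvu, hu⟩ := h2
      obtain ⟨w, huw, hN⟩ := exists_neighborFinset_eq_pair hv2 hvu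
      have hvw : G.Adj v w := by
        rw [← mem_neighborFinset, hN]
        simp
      have h1 := one_le_degree_of_adj hvw.symm
      have hz' := hz v
      -- Nonpositive excess at `v` leaves only `deg w = 1`, so `w` has weight 1 and `3 + 1 = 2 * 2`.
      rw [hN, Finset.sum_pair huw] at hz'
      rw [hN, Finset.sum_pair huw, x3 u hu, x1 w (by omega) ⟨v, hvw.symm, hv2, u, hvu, hu⟩]
      norm_num
    by_cases h1 : G.degree v = 1 ∧
        ∃ u, G.Adj v u ∧ G.degree u = 2 ∧ ∃ w, G.Adj u w ∧ 3 ≤ G.degree w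
    · rw [x1 v h1.1 h1.2]
      obtain ⟨hv1, u, hvu, hu2, hw⟩ := h1
      rw [neighborFinset_eq_singleton hv1 hvu, Finset.sum_singleton, x2 u hu2 hw]
      norm_num
    · have : x v = 0 := by
        simp only [x]
        rw [if_neg h3, if_neg h2, if_neg h1]
      rw [this, mul_zero]
      exact Finset.sum_nonneg fun u _ => x0 u
  by_contra! hv
  have := x3 v hv
  rw [hx] at this
  norm_num at this

/-- A vertex of degree at least 3 and its neighbours alone contribute at least `3 + 3` to the degree
sum. -/
theorem degree_le_two_of_sum_le (hd : ∑ v, G.degree v ≤ 4) (v : V) : G.degree v ≤ 2 := by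
  by_contra! hv
  have h1 : G.degree v + ∑ u ∈ G.neighborFinset v, 1 ≤ ∑ v, G.degree v := by
    rw [← Finset.add_sum_erase _ _ (Finset.mem_univ v)]
    refine Nat.add_le_add_left ((Finset.sum_le_sum fun u hu => ?_).trans
      (Finset.sum_le_sum_of_subset (fun u hu => ?_))) _
    · exact one_le_degree_of_adj ((mem_neighborFinset _ _ _).1 hu).symm
    · have := (mem_neighborFinset _ _ _).1 hu
      simp [this.ne']
  rw [Finset.sum_const, card_neighborFinset_eq_degree, smul_eq_mul] at h1
  omega

/-- A graph of maximum degree at most two with exactly two vertices of degree one and without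
`2`-superharmonic vectors consists of a path and isolated vertices. -/
theorem exists_isPathOn (hS : G.NoTwoSuperharmonic) (hd : ∀ v, G.degree v ≤ 2)
    (hl : (Finset.univ.filter fun v => G.degree v = 1).card = 2) :
    ∃ k ≥ 2, ∃ f, G.IsPathOn f k := by
  obtain ⟨a, ha⟩ : ∃ a, G.degree a = 1 := by
    obtain ⟨a, ha⟩ := Finset.card_pos.1 (hl.symm ▸ two_pos)
    exact ⟨a, by simpa using ha⟩
  obtain ⟨a', haa'⟩ := (G.degree_pos_iff_exists_adj a).1 (by omega)
  let Q : ℕ → Prop := fun k => ∃ f : ℕ → V, f 0 = a ∧ Set.InjOn f (Set.Iio k) ∧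
    ∀ i, i + 1 < k → G.Adj (f i) (f (i + 1))
  have hQ2 : Q 2 := by
    refine ⟨fun i => if i = 0 then a else a', rfl, ?_, ?_⟩
    · intro i hi j hj hij
      simp only [Set.mem_Iio] at hi hj
      dsimp only at hij
      split_ifs at hij
      · omega
      · exact absurd hij haa'.ne
      · exact absurd hij haa'.ne'
      · omega
    · intro i hi
      obtain rfl : i = 0 := by omega
      simpa using haa'
  have hQc : ∀ k, Q k → k ≤ Fintype.card V := by
    rintro k ⟨f, -, hf, -⟩
    rw [← Finset.card_range k, ← Finset.card_univ]
    refine Finset.card_le_card_of_injOn f (fun _ _ => Finset.mem_coe.2 (Finset.mem_univ _)) ?_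
    simpa using hf
  -- Take a longest path starting at the leaf `a`.
  obtain ⟨k, hk2, hQk, hmax⟩ : ∃ k, 2 ≤ k ∧ Q k ∧ ¬ Q (k + 1) :=
    ⟨Nat.findGreatest Q (Fintype.card V), Nat.le_findGreatest (hQc 2 hQ2) hQ2,
      Nat.findGreatest_spec (hQc 2 hQ2) hQ2, fun h =>
        Nat.lt_irrefl _ (Nat.le_findGreatest (hQc _ h) h)⟩
  obtain ⟨f, hf0, hinj, hadj⟩ := hQk
  have hinj' : ∀ i j, i < k → j < k → f i = f j → i = j := fun i j hi hj h => hinj hi hj h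
  have hfirst : ∀ u, G.Adj (f 0) u → u = f 1 := by
    intro u hu
    have h1 := neighborFinset_eq_singleton (hf0 ▸ ha) (hadj 0 (by omega))
    have : u ∈ G.neighborFinset (f 0) := by simpa using hu
    rw [h1] at this
    simpa using this
  have hmid : ∀ i u, i + 2 < k → G.Adj (f (i + 1)) u → u = f i ∨ u = f (i + 2) := by
    intro i u hi hu
    have h1 := (hadj i (by omega)).symm
    have h2 := hadj (i + 1) hi
    have hne : f i ≠ f (i + 2) := fun h => by
      have := hinj' _ _ (by omega) (by omega) h
      omega
    have hdeg : G.degree (f (i + 1)) = 2 := by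
      refine le_antisymm (hd _) ?_
      rw [← card_neighborFinset_eq_degree, ← Finset.card_pair hne]
      exact Finset.card_le_card (by simp [Finset.insert_subset_iff, h1, h2])
    have h3 : u ∈ G.neighborFinset (f (i + 1)) := by simpa using hu
    rw [neighborFinset_eq_pair hdeg h1 h2 hne] at h3
    simpa using h3
  have hlast : ∀ u, G.Adj (f (k - 1)) u → u = f (k - 2) := by
    intro u hu
    have hur : ∃ j < k, u = f j := by
      by_contra! hne
      -- A neighbour of the last vertex off the path would extend it.
      refine hmax ⟨fun i => if i < k then f i else u, by simp [hf0]; omega, ?_, ?_⟩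
      · intro i hi j hj hij
        simp only [Set.mem_Iio] at hi hj
        dsimp only at hij
        split_ifs at hij with h1 h2 h2
        · exact hinj' _ _ h1 h2 hij
        · exact absurd hij.symm (hne i h1)
        · exact absurd hij (hne j h2)
        · omega
      · intro i hi
        dsimp only
        rw [if_pos (by omega)]
        split_ifs with h
        · exact hadj i h
        · obtain rfl : i = k - 1 := by omega
          exact hu
    obtain ⟨j, hj, rfl⟩ := hur
    rcases j with _ | j
    · have := hinj' _ _ (by omega) (by omega) (hfirst _ hu.symm)
      rw [show k - 2 = 0 by omega]
    · rcases lt_or_ge (j + 2) k with h | h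
      · rcases hmid j _ h hu.symm with h1 | h1
        · have := hinj' _ _ (by omega) (by omega) h1
          omega
        · have := hinj' _ _ (by omega) (by omega) h1
          rw [show k - 2 = j + 1 by omega]
      · exact absurd (by rw [show j + 1 = k - 1 by omega]) hu.ne
  have hnb : ∀ i < k, ∀ u, G.Adj (f i) u → 0 < i ∧ u = f (i - 1) ∨ i + 1 < k ∧ u = f (i + 1) := by
    intro i hi u hu
    rcases i with _ | i
    · exact Or.inr ⟨by omega, hfirst u hu⟩
    · rcases lt_or_ge (i + 2) k with h | h
      · exact (hmid i u h hu).imp (fun h => ⟨by omega, h⟩) fun h' => ⟨h, h'⟩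
      · obtain rfl : k = i + 2 := by omega
        exact Or.inl ⟨by omega, hlast u hu⟩
  have hlastdeg : G.degree (f (k - 1)) = 1 := by
    refine Finset.card_eq_one.2 ⟨f (k - 2), Finset.ext fun u => ?_⟩
    rw [mem_neighborFinset, Finset.mem_singleton]
    refine ⟨hlast u, ?_⟩
    rintro rfl
    have := hadj (k - 2) (by omega)
    rw [show k - 2 + 1 = k - 1 by omega] at this
    exact this.symm
  have hleaves : ∀ v, G.degree v = 1 → ∃ i < k, v = f i := by
    have hne : f 0 ≠ f (k - 1) := fun h => by
      have := hinj' _ _ (by omega) (by omega) h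
      omega
    have : ({f 0, f (k - 1)} : Finset V) = Finset.univ.filter fun v => G.degree v = 1 := by
      refine Finset.eq_of_subset_of_card_le ?_ (by rw [hl, Finset.card_pair hne])
      simp [Finset.insert_subset_iff, hlastdeg, hf0, ha]
    intro v hv
    have hv' : v ∈ Finset.univ.filter fun v => G.degree v = 1 := by simpa using hv
    rw [← this, Finset.mem_insert, Finset.mem_singleton] at hv'
    rcases hv' with rfl | rfl
    exacts [⟨0, by omega, rfl⟩, ⟨k - 1, by omega, rfl⟩]
  -- Both leaves are ends of the path, so the other nonisolated vertices induce a 2-regular graph;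
  -- its indicator satisfies `2x ≤ Ax` and must vanish.
  let x : V → ℝ := fun v => if G.degree v = 2 ∧ ∀ i < k, v ≠ f i then 1 else 0
  have x0 : ∀ v, 0 ≤ x v := by
    intro v
    simp only [x]
    split_ifs <;> norm_num
  have hx := hS x x0 fun v => by
    by_cases hv : G.degree v = 2 ∧ ∀ i < k, v ≠ f i
    · have hxu : ∀ u ∈ G.neighborFinset v, x u = 1 := by
        intro u hu
        have hvu : G.Adj v u := by simpa using hu
        have hout : ∀ i < k, u ≠ f i := by
          rintro i hi rfl
          rcases hnb i hi v hvu.symm with ⟨-, h⟩ | ⟨h', h⟩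
          · exact hv.2 _ (by omega) h
          · exact hv.2 _ h' h
        have h1 := one_le_degree_of_adj hvu.symm
        have h2 := hd u
        have h3 : G.degree u ≠ 1 := fun h => by
          obtain ⟨i, hi, hui⟩ := hleaves u h
          exact hout i hi hui
        exact if_pos ⟨by omega, hout⟩
      rw [Finset.sum_congr rfl hxu, Finset.sum_const, card_neighborFinset_eq_degree, hv.1]
      simp only [x, if_pos hv]
      norm_num
    · have : x v = 0 := if_neg hv
      rw [this, mul_zero]
      exact Finset.sum_nonneg fun u _ => x0 u
  refine ⟨k, hk2, f, hinj, fun u v => ⟨fun huv => ?_, ?_⟩⟩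
  · have hu : ∃ i < k, u = f i := by
      by_contra! hu
      have h1 := one_le_degree_of_adj huv
      have h2 := hd u
      have h3 : G.degree u ≠ 1 := fun h => by
        obtain ⟨i, hi, hui⟩ := hleaves u h
        exact hu i hi hui
      have h4 : x u = 1 := if_pos ⟨by omega, hu⟩
      rw [hx] at h4
      norm_num at h4
    obtain ⟨i, hi, rfl⟩ := hu
    rcases hnb i hi v huv with ⟨h0, h⟩ | ⟨h0, h⟩
    · exact ⟨i - 1, by omega, Or.inr ⟨h, by rw [Nat.sub_add_cancel h0]⟩⟩
    · exact ⟨i, h0, Or.inl ⟨rfl, h⟩⟩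
  · rintro ⟨i, hi, ⟨rfl, rfl⟩ | ⟨rfl, rfl⟩⟩
    exacts [hadj i hi, (hadj i hi).symm]

/-! ### From walk counts to degree conditions -/

theorem excessVec_adjMatrix (v : V) :
    excessVec (G.adjMatrix ℝ) v = ((∑ u ∈ G.neighborFinset v, ((G.degree u : ℤ) - 2) : ℤ) : ℝ) := by
  rw [excessVec, adjMatrix_mulVec_apply]
  push_cast
  refine Finset.sum_congr rfl fun u _ => ?_
  rw [Pi.sub_apply, adjMatrix_mulVec_apply]
  simp

theorem walkSum_adjMatrix_one : walkSum (G.adjMatrix ℝ) 1 = ((∑ v, G.degree v : ℕ) : ℝ) := by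
  rw [_root_.walkSum_one]
  push_cast
  refine Finset.sum_congr rfl fun u _ => ?_
  rw [adjMatrix_mulVec_apply]
  simp

theorem sum_excessVec_adjMatrix :
    ∑ v, excessVec (G.adjMatrix ℝ) v = ((∑ v, (G.degree v : ℤ) * (G.degree v - 2) : ℤ) : ℝ) := by
  have hs : (G.adjMatrix ℝ).IsSymm := G.isSymm_adjMatrix
  rw [_root_.sum_excessVec, walkSum_add hs 1 1, _root_.walkSum_one, pow_one]
  push_cast
  rw [dotProduct, Finset.mul_sum, ← Finset.sum_sub_distrib]
  refine Finset.sum_congr rfl fun u _ => ?_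
  have : (G.adjMatrix ℝ *ᵥ 1) u = G.degree u := by
    rw [adjMatrix_mulVec_apply]
    simp
  rw [this]
  ring

/-- The integers `z² + z` are nonnegative and sum to `2 - 2 = 0`, so each `z` is 0 or -1. -/
theorem excess_nonpos (h1 : ∑ v, excessVec (G.adjMatrix ℝ) v = -2)
    (h2 : ∑ v, excessVec (G.adjMatrix ℝ) v ^ 2 = 2) (v : V) :
    ∑ u ∈ G.neighborFinset v, ((G.degree u : ℤ) - 2) ≤ 0 := by
  simp only [excessVec_adjMatrix] at h1 h2
  set z : V → ℤ := fun v => ∑ u ∈ G.neighborFinset v, ((G.degree u : ℤ) - 2)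
  change z v ≤ 0
  have h1' : ∑ v, z v = -2 := by exact_mod_cast h1
  have h2' : ∑ v, z v ^ 2 = 2 := by exact_mod_cast h2
  have h3 : ∑ v, (z v ^ 2 + z v) = 0 := by rw [Finset.sum_add_distrib, h1', h2']; norm_num
  rw [Finset.sum_eq_zero_iff_of_nonneg fun v _ => by
    rcases le_or_gt 0 (z v) with h | h <;> nlinarith] at h3
  have := h3 v (Finset.mem_univ v)
  nlinarith

/-- For `d ≤ 2`, `d (d - 2)` is -1 when `d = 1` and 0 otherwise. -/
theorem card_filter_degree_eq_one (hd : ∀ v, G.degree v ≤ 2)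
    (h1 : ∑ v, excessVec (G.adjMatrix ℝ) v = -2) :
    (Finset.univ.filter fun v => G.degree v = 1).card = 2 := by
  rw [sum_excessVec_adjMatrix] at h1
  have h2 : ∑ v, (G.degree v : ℤ) * (G.degree v - 2) = -2 := by exact_mod_cast h1
  have h3 : ∑ v, (G.degree v : ℤ) * (G.degree v - 2) = ∑ v, -(if G.degree v = 1 then 1 else 0) := by
    refine Finset.sum_congr rfl fun v _ => ?_
    have := hd v
    interval_cases G.degree v <;> norm_num
  rw [h3, Finset.sum_neg_distrib, Finset.sum_boole] at h2
  have h4 := neg_injective h2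
  exact_mod_cast h4

theorem isHermitian_adjMatrix_real {V : Type*} (G : SimpleGraph V) :
    (G.adjMatrix ℝ).IsHermitian := by
  rw [Matrix.IsHermitian, Matrix.conjTranspose_eq_transpose_of_trivial]
  exact G.isSymm_adjMatrix

theorem IsPathOn.noTwoSuperharmonic [Fintype W] {H : SimpleGraph W} {f : ℕ → W} {ℓ : ℕ}
    (h : H.IsPathOn f ℓ) (hc : (G.adjMatrix ℝ).charpoly = (H.adjMatrix ℝ).charpoly) :
    G.NoTwoSuperharmonic := by
  intro x hx hGx
  refine eq_zero_of_two_mul_le_mulVec G.isHermitian_adjMatrix_real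
    (fun μ hμ => h.lt_two_of_isRoot (hc ▸ hμ)) hx fun v => ?_
  rw [adjMatrix_mulVec_apply]
  exact hGx v

/-- A graph whose adjacency matrix `A` has the same characteristic polynomials of `A` and `A - J`
as a path with isolated vertices is a path with isolated vertices. -/
theorem IsPathOn.nonempty_iso_of_charpoly_eq [Fintype W] {H : SimpleGraph W} {f : ℕ → W} {ℓ : ℕ}
    (h : H.IsPathOn f ℓ) (hℓ : 2 ≤ ℓ) (hc : (G.adjMatrix ℝ).charpoly = (H.adjMatrix ℝ).charpoly)
    (hc' : (G.adjMatrix ℝ - Matrix.of fun _ _ => 1).charpoly =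
      (H.adjMatrix ℝ - Matrix.of fun _ _ => 1).charpoly) : Nonempty (H ≃g G) := by
  have hw := walkSum_eq_of_charpoly_eq hc hc'
  have hS := h.noTwoSuperharmonic hc
  have e1 : ∑ v, excessVec (G.adjMatrix ℝ) v = -2 := by
    rw [← h.sum_excessVec hℓ, _root_.sum_excessVec, _root_.sum_excessVec, hw]
  have hd : ∀ v, G.degree v ≤ 2 := by
    -- The second moment is not 2 for `ℓ = 3`; for `ℓ ≤ 3` the degree sum `2 (ℓ - 1) ≤ 4` suffices.
    rcases lt_or_ge ℓ 4 with h4 | h4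
    · refine degree_le_two_of_sum_le ?_
      have := (congrFun hw 1).trans (h.walkSum_one hℓ)
      rw [walkSum_adjMatrix_one] at this
      have h5 : ((∑ v, G.degree v : ℕ) : ℝ) ≤ 4 := by
        have : (ℓ : ℝ) ≤ 3 := by exact_mod_cast (by omega : ℓ ≤ 3)
        linarith
      exact_mod_cast h5
    · refine degree_le_two_of_excess_nonpos hS (excess_nonpos e1 ?_)
      rw [← h.sum_excessVec_sq h4, _root_.sum_excessVec_sq G.isSymm_adjMatrix,
        _root_.sum_excessVec_sq H.isSymm_adjMatrix, hw]
  obtain ⟨k, hk, g, hg⟩ := exists_isPathOn hS hd (card_filter_degree_eq_one hd e1)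
  have hkℓ := (hg.walkSum_one hk).symm.trans ((congrFun hw 1).trans (h.walkSum_one hℓ))
  obtain rfl : k = ℓ := by
    have : (k : ℝ) = ℓ := by linarith
    exact_mod_cast this
  exact h.nonempty_iso hg (card_eq_of_charpoly_eq hc).symm

theorem eq_bot_of_charpoly_eq [Fintype W] {H : SimpleGraph W} (hH : H = ⊥)
    (hc : (G.adjMatrix ℝ).charpoly = (H.adjMatrix ℝ).charpoly)
    (hc' : (G.adjMatrix ℝ - Matrix.of fun _ _ => 1).charpoly =
      (H.adjMatrix ℝ - Matrix.of fun _ _ => 1).charpoly) : G = ⊥ := by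
  have hw := congrFun (walkSum_eq_of_charpoly_eq hc hc') 1
  rw [walkSum_adjMatrix_one, walkSum_adjMatrix_one, Nat.cast_inj] at hw
  have h0 : ∑ v, H.degree v = 0 := Finset.sum_eq_zero fun v _ => by
    by_contra hv
    obtain ⟨u, hu⟩ := (H.degree_pos_iff_exists_adj v).1 (Nat.pos_of_ne_zero hv)
    rw [hH] at hu
    exact hu
  rw [h0, Finset.sum_eq_zero_iff] at hw
  refine eq_bot_iff.2 fun u v huv => ?_
  have := one_le_degree_of_adj huv
  rw [hw u (Finset.mem_univ u)] at this
  omega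

/-! ### Complements and the final assembly -/

theorem adjMatrix_compl_eq {V : Type*} (G : SimpleGraph V) [DecidableRel Gᶜ.Adj] :
    Gᶜ.adjMatrix ℝ = -(1 + (G.adjMatrix ℝ - Matrix.of fun _ _ => 1)) := by
  ext u v
  by_cases h : u = v
  · subst h
    simp
  · by_cases h' : G.Adj u v <;> simp [h, h', adjMatrix_apply]

theorem adjMatrix_compl_sub_ones {V : Type*} (G : SimpleGraph V)
    [inst : DecidableRel Gᶜ.Adj] : Gᶜ.adjMatrix ℝ - Matrix.of (fun _ _ => 1) =
      -(1 + G.adjMatrix ℝ) := by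
  rw [adjMatrix_compl_eq]
  abel

end SimpleGraph

theorem Cospectral.charpoly_eq [Fintype W] {G : SimpleGraph V} {H : SimpleGraph W}
    (h : Cospectral G H) : (G.adjMatrix ℝ).charpoly = (H.adjMatrix ℝ).charpoly :=
  charpoly_eq_of_roots_eq G.isHermitian_adjMatrix_real H.isHermitian_adjMatrix_real h

/-- The shift `α = 0` gives the graphs and `α = -1` gives `A - J`, hence the complements, with
adjacency matrix `-(1 + (A - J))`. -/
theorem RCospectral.generalizedCospectral [Fintype W] {G : SimpleGraph V} {H : SimpleGraph W}
    (h : RCospectral G H) : GeneralizedCospectral G H := by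
  have h0 := h 0
  have h1 := h (-1)
  simp only [shiftedSpectrum, zero_smul, add_zero] at h0
  simp only [shiftedSpectrum, neg_smul, one_smul, ← sub_eq_add_neg] at h1
  refine ⟨h0, ?_⟩
  have hc := charpoly_eq_of_roots_eq (G.isHermitian_adjMatrix_real.sub (by ext; simp))
    (H.isHermitian_adjMatrix_real.sub (by ext; simp)) h1
  rw [Cospectral, adjSpectrum, adjSpectrum, SimpleGraph.adjMatrix_compl_eq,
    SimpleGraph.adjMatrix_compl_eq, charpoly_neg_one_add_eq hc]

theorem SimpleGraph.compl_deleteEdges_top_adj {V : Type*} (P : (⊤ : SimpleGraph V).Subgraph)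
    (u v : V) : ((⊤ : SimpleGraph V).deleteEdges P.edgeSet)ᶜ.Adj u v ↔ P.Adj u v := by
  rw [SimpleGraph.compl_adj, SimpleGraph.deleteEdges_adj, SimpleGraph.top_adj,
    SimpleGraph.Subgraph.mem_edgeSet]
  have : P.Adj u v → u ≠ v := fun h => h.adj_sub
  tauto

theorem SimpleGraph.exists_isPathOn_of_iso_pathGraph {V : Type*} {G : SimpleGraph V}
    {P : G.Subgraph} {H : SimpleGraph V} {ℓ : ℕ} (hH : ∀ u v, H.Adj u v ↔ P.Adj u v)
    (e : P.coe ≃g SimpleGraph.pathGraph ℓ) (hℓ : 0 < ℓ) : ∃ f, H.IsPathOn f ℓ := by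
  -- The value at indices from `ℓ` on is arbitrary; only `i < ℓ` matters.
  let f : ℕ → V := fun i => e.symm (if hi : i < ℓ then ⟨i, hi⟩ else ⟨0, hℓ⟩)
  have hf : ∀ i (hi : i < ℓ), f i = e.symm ⟨i, hi⟩ := fun i hi => by simp only [f, dif_pos hi]
  refine ⟨f, fun i hi j hj hij => ?_, fun u v => ?_⟩
  · rw [hf i hi, hf j hj] at hij
    exact Fin.mk.inj (e.symm.injective (Subtype.ext hij))
  rw [hH]
  constructor
  · intro huv
    have h : P.coe.Adj ⟨u, huv.fst_mem⟩ ⟨v, huv.snd_mem⟩ := huv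
    rw [← e.map_adj_iff, SimpleGraph.pathGraph_adj] at h
    have hu : u = f (e ⟨u, huv.fst_mem⟩) := by rw [hf _ (Fin.is_lt _)]; simp
    have hv : v = f (e ⟨v, huv.snd_mem⟩) := by rw [hf _ (Fin.is_lt _)]; simp
    rcases h with h | h
    · exact ⟨_, h ▸ Fin.is_lt _, Or.inl ⟨hu, h ▸ hv⟩⟩
    · exact ⟨_, h ▸ Fin.is_lt _, Or.inr ⟨hv, h ▸ hu⟩⟩
  · have key : ∀ i, i + 1 < ℓ → P.Adj (f i) (f (i + 1)) := by
      intro i hi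
      rw [hf i (by omega), hf (i + 1) hi]
      have : P.coe.Adj (e.symm ⟨i, by omega⟩) (e.symm ⟨i + 1, hi⟩) := by
        rw [e.symm.map_adj_iff, SimpleGraph.pathGraph_adj]
        exact Or.inl rfl
      exact this
    rintro ⟨i, hi, ⟨rfl, rfl⟩ | ⟨rfl, rfl⟩⟩
    exacts [key i hi, (key i hi).symm]

theorem SimpleGraph.nonempty_iso_of_compl {V W : Type*} {G : SimpleGraph V} {H : SimpleGraph W}
    (h : Nonempty (Gᶜ ≃g Hᶜ)) : Nonempty (G ≃g H) := by
  obtain ⟨e⟩ := h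
  refine ⟨⟨e.toEquiv, fun {u v} => ?_⟩⟩
  have h1 := e.map_adj_iff (v := u) (w := v)
  have h2 : e u = e v ↔ u = v := e.injective.eq_iff
  have h3 : H.Adj (e u) (e v) → e u ≠ e v := fun h => h.ne
  have h4 : G.Adj u v → u ≠ v := fun h => h.ne
  simp only [SimpleGraph.compl_adj] at h1
  change H.Adj (e u) (e v) ↔ G.Adj u v
  tauto

theorem GeneralizedCospectral.nonempty_iso_of_path [Fintype W] {ℓ : ℕ}
    {P : (⊤ : SimpleGraph V).Subgraph}
    (hP : Nonempty (P.coe ≃g SimpleGraph.pathGraph ℓ)) {H : SimpleGraph W}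
    (h : GeneralizedCospectral ((⊤ : SimpleGraph V).deleteEdges P.edgeSet) H) :
    Nonempty ((⊤ : SimpleGraph V).deleteEdges P.edgeSet ≃g H) := by
  obtain ⟨e⟩ := hP
  set G := (⊤ : SimpleGraph V).deleteEdges P.edgeSet
  have hadj : ∀ u v, Gᶜ.Adj u v ↔ P.Adj u v := SimpleGraph.compl_deleteEdges_top_adj P
  have hc := h.2.charpoly_eq.symm
  have hc' := (charpoly_neg_one_add_eq h.1.charpoly_eq).symm
  rw [← G.adjMatrix_compl_sub_ones (inst := fun _ _ => Classical.propDecidable _),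
    ← H.adjMatrix_compl_sub_ones (inst := fun _ _ => Classical.propDecidable _)] at hc'
  apply SimpleGraph.nonempty_iso_of_compl
  -- For `ℓ ≤ 1` nothing is deleted and the complement is edgeless, so counting edges suffices.
  rcases lt_or_ge ℓ 2 with hℓ | hℓ
  · have hbot : Gᶜ = ⊥ := by
      refine eq_bot_iff.2 fun u v huv => ?_
      have huv' := (hadj u v).1 huv
      have hs : Subsingleton (Fin ℓ) := by
        rw [Fin.subsingleton_iff_le_one]
        omega
      have := e.injective (Subsingleton.elim (e ⟨u, huv'.fst_mem⟩) (e ⟨v, huv'.snd_mem⟩))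
      exact huv.ne (congrArg Subtype.val this)
    rw [SimpleGraph.eq_bot_of_charpoly_eq hbot hc hc', hbot]
    exact ⟨⟨Fintype.equivOfCardEq (card_eq_of_charpoly_eq hc).symm, by simp⟩⟩
  · obtain ⟨f, hf⟩ := SimpleGraph.exists_isPathOn_of_iso_pathGraph hadj e (by omega)
    exact hf.nonempty_iso_of_charpoly_eq hℓ hc hc'

end Degrees

theorem mainTheorem4 {W : Type*} [Fintype W] (n ℓ : ℕ)
    (P : (⊤ : SimpleGraph (Fin n)).Subgraph)
    (hP : Nonempty (P.coe ≃g SimpleGraph.pathGraph ℓ)) (H : SimpleGraph W) :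
    (GeneralizedCospectral ((⊤ : SimpleGraph (Fin n)).deleteEdges P.edgeSet) H →
      Nonempty ((⊤ : SimpleGraph (Fin n)).deleteEdges P.edgeSet ≃g H)) ∧
    (RCospectral ((⊤ : SimpleGraph (Fin n)).deleteEdges P.edgeSet) H →
      Nonempty ((⊤ : SimpleGraph (Fin n)).deleteEdges P.edgeSet ≃g H)) :=
  ⟨fun h => h.nonempty_iso_of_path hP,
    fun h => h.generalizedCospectral.nonempty_iso_of_path hP⟩
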